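/- Let $\mathbb K$ be an infinite field, let $n,p,d$ be integers with $1\le p<n$ and $d\ge 1$, and let $R=\mathbb K[x_1,\dots,x_n]$. For an ideal $I\subset R$ let $I^{\mathrm{top}}$ be the homogeneous ideal generated by the top-degree homogeneous components of the elements of $I$ (so $I^{\mathrm{top}}=I$ if $I$ is homogeneous). Let $H\in\mathbb Z[[t]]$ be the Hilbert series of $R/I$, understood as that of its associated graded algebra $R/I^{\mathrm{top}}$, and for $e\ge 1$ let $HQ_e$ be the Hilbert series of $R/(I^{\mathrm{top}}+\langle x_n^e\rangle)$, the quotient of this graded algebra by $x_n^e$. For a series $S$ let $[S]_+$ denote $S$ truncated at its first non-positive coefficient (that coefficient and all later ones are replaced by $0$). Call $I$ a generic determinantal ideal with parameters $n,p,d$ if the following three conditions hold. 1. $I$ is in shape position: for the lexicographic order with $x_1>\dots>x_n$ it has a Gröbner basis of the form $\{x_1-g_1(x_n),\dots,x_{n-1}-g_{n-1}(x_n),\,g_n(x_n)\}$ with univariate polynomials $g_i$, $g_n\neq 0$. 2. The Hilbert series $H$ is $$H=\frac{\det P(t^{d-1})}{t^{(d-1)\binom{p-1}{2}}}\cdot\frac{(1-t^d)^p(1-t^{d-1})^{n-p}}{(1-t)^n},$$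 where $P(t)$ is the $(p-1)\times(p-1)$ matrix with $(i,j)$ entry $\sum_{k}\binom{p-i}{k}\binom{n-1-j}{k}t^k$, $1\le i,j\le p-1$ (the determinant being $1$ if $p=1$). 3. $HQ_e=[(1-t^e)H]_+$ for all $e\ge 1$. Let $I$ be a generic determinantal ideal with parameters $n,p,d$, let $G$ be its reduced Gröbner basis for the degree reverse lexicographic order with $x_1>\dots>x_n$, and let $E$ be the DRL staircase of $I$, that is, the set of monomials that are divisible by no leading monomial of an element of $G$. Then for every $b\in E$, either $x_nb\in E$ or $x_nb$ is the leading monomial of an element of $G$. -/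

import Mathlib

open MvPolynomial

/-! ### The degree reverse lexicographic order -/

/-- Exponent vectors of monomials in `n` variables, to be ordered by DRL. -/
def DRL (n : ℕ) : Type := Fin n →₀ ℕ

namespace DRL

noncomputable instance (n : ℕ) : AddCommMonoid (DRL n) :=
  inferInstanceAs (AddCommMonoid (Fin n →₀ ℕ))

/-- The vector of partial sums `(a₀ + ⋯ + aₙ₋₁, a₀ + ⋯ + aₙ₋₂, …, a₀)`, in the lexicographic
order. Comparing these vectors lexicographically is comparing `a` by DRL, see `lt_iff`. -/
def key {n : ℕ} (a : DRL n) : Lex (Fin n → ℕ) :=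
  toLex fun i => ∑ j ∈ Finset.Iic i.rev, (show Fin n →₀ ℕ from a) j

theorem key_apply {n : ℕ} (a : Fin n →₀ ℕ) (i : Fin n) :
    key (n := n) a i = ∑ j ∈ Finset.Iic i.rev, a j := rfl

theorem key_add {n : ℕ} (a b : DRL n) : key (a + b) = key a + key b := by
  funext i
  exact Finset.sum_add_distrib

theorem sum_Iic_split {n : ℕ} (a : Fin n → ℕ) (i : Fin n) :
    ∑ j ∈ Finset.Iic i, a j = ∑ j ∈ Finset.Iio i, a j + a i := by
  rw [← Finset.Iio_insert, Finset.sum_insert (by simp), add_comm]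

theorem sum_split {n : ℕ} (a : Fin n → ℕ) (i : Fin n) :
    ∑ j, a j = ∑ j ∈ Finset.Iic i, a j + ∑ j ∈ Finset.Ioi i, a j := by
  rw [← Finset.sum_union (by
    rw [Finset.disjoint_left]; intro x hx hy
    exact absurd (Finset.mem_Iic.1 hx) (not_le.2 (Finset.mem_Ioi.1 hy)))]
  congr 1
  ext x
  simp [le_or_gt]

theorem key_injective {n : ℕ} : Function.Injective (key (n := n)) := by
  intro a b h
  have hs : ∀ i : Fin n, ∑ j ∈ Finset.Iic i, (show Fin n →₀ ℕ from a) j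
      = ∑ j ∈ Finset.Iic i, (show Fin n →₀ ℕ from b) j := by
    intro i
    have := congrFun (congrArg ofLex h) i.rev
    simpa [key] using this
  refine Finsupp.ext (f := (show Fin n →₀ ℕ from a)) (g := (show Fin n →₀ ℕ from b)) ?_
  intro i
  induction i using WellFoundedLT.induction with
  | ind i ih =>
    have h1 := hs i
    rw [sum_Iic_split, sum_Iic_split, Finset.sum_congr rfl
      (fun j hj => ih j (Finset.mem_Iio.1 hj))] at h1
    exact Nat.add_left_cancel h1

noncomputable instance (n : ℕ) : LinearOrder (DRL n) := LinearOrder.lift' key key_injective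

theorem le_def {n : ℕ} {a b : DRL n} : a ≤ b ↔ key a ≤ key b := Iff.rfl

theorem lt_def {n : ℕ} {a b : DRL n} : a < b ↔ key a < key b := Iff.rfl

instance (n : ℕ) : IsOrderedAddMonoid (DRL n) where
  add_le_add_left a b h c := by
    rw [le_def] at h ⊢
    rw [key_add, key_add]
    exact add_le_add_left h _

instance (n : ℕ) : WellFoundedLT (DRL n) :=
  ⟨InvImage.wf key (wellFounded_lt (α := Lex (Fin n → ℕ)))⟩

end DRL

/-- The degree reverse lexicographic order on the monomials in `X 0 > X 1 > ⋯ > X (n - 1)`,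
so that the last variable is the least one. -/
noncomputable def drl (n : ℕ) : MonomialOrder (Fin n) where
  syn := DRL n
  toSyn :=
    { toFun := fun a => a
      invFun := fun a => a
      left_inv := fun _ => rfl
      right_inv := fun _ => rfl
      map_add' := fun _ _ => rfl }
  toSyn_monotone := by
    intro a b h
    refine DRL.le_def.2 (Pi.toLex_monotone ?_)
    intro i
    exact Finset.sum_le_sum fun j _ => h j

open scoped MonomialOrder in
/-- The usual description of DRL: compare total degrees first; in case of a tie, look at the last
variable in which the exponents differ: the monomial with the larger exponent is the smaller one. -/
theorem drl_lt_iff {n : ℕ} (a b : Fin n →₀ ℕ) :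
    a ≺[drl n] b ↔ ∑ i, a i < ∑ i, b i ∨
      (∑ i, a i = ∑ i, b i ∧ ∃ i, (∀ j, i < j → a j = b j) ∧ b i < a i) := by
  have key0 : ∀ (c : Fin n →₀ ℕ) (i : Fin n),
      DRL.key (n := n) c i = ∑ j ∈ Finset.Iic i.rev, c j := fun _ _ => rfl
  have tail : ∀ i : Fin n, (∀ j, i < j → a j = b j) →
      ∑ j ∈ Finset.Ioi i, a j = ∑ j ∈ Finset.Ioi i, b j := fun i h =>
    Finset.sum_congr rfl fun j hj => h j (Finset.mem_Ioi.1 hj)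
  have full : ∀ (c : Fin n →₀ ℕ) (i : Fin n), i.val + 1 = n →
      ∑ j ∈ Finset.Iic i, c j = ∑ j, c j := by
    intro c i hi
    congr 1
    ext x
    have := x.isLt
    simp only [Finset.mem_Iic, Finset.mem_univ, iff_true, Fin.le_def]
    omega
  have succ : ∀ (c : Fin n →₀ ℕ) (i k : Fin n), k.val = i.val + 1 →
      ∑ j ∈ Finset.Iic k, c j = ∑ j ∈ Finset.Iic i, c j + c k := by
    intro c i k hk
    rw [DRL.sum_Iic_split]
    congr 2
    ext x
    simp only [Finset.mem_Iic, Finset.mem_Iio, Fin.le_def, Fin.lt_def]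
    omega
  -- equal partial sums above level `k` and equal total sums, versus equal exponents
  have cmp : a ≺[drl n] b ↔ ∃ i : Fin n,
      (∀ j, i < j → ∑ l ∈ Finset.Iic j, a l = ∑ l ∈ Finset.Iic j, b l) ∧
        ∑ l ∈ Finset.Iic i, a l < ∑ l ∈ Finset.Iic i, b l := by
    constructor
    · rintro ⟨i, h1, h2⟩
      refine ⟨i.rev, fun j hj => ?_, h2⟩
      have := h1 j.rev (Fin.rev_lt_iff.2 hj)
      change DRL.key (n := n) a j.rev = DRL.key (n := n) b j.rev at this
      rwa [key0, key0, Fin.rev_rev] at this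
    · rintro ⟨i, h1, h2⟩
      refine ⟨i.rev, fun j hj => ?_, ?_⟩
      · exact h1 j.rev (Fin.lt_rev_iff.2 hj)
      · change DRL.key (n := n) a i.rev < DRL.key (n := n) b i.rev
        rwa [key0, key0, Fin.rev_rev]
  rw [cmp]
  constructor
  · rintro ⟨i, h1, h2⟩
    by_cases hi : i.val + 1 = n
    · left
      rwa [full a i hi, full b i hi] at h2
    · have hin : i.val + 1 < n := by have := i.isLt; omega
      have hlast : (⟨n - 1, by omega⟩ : Fin n).val + 1 = n := by simp only; omega
      right
      refine ⟨?_, ⟨i.val + 1, hin⟩, ?_, ?_⟩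
      · have := h1 ⟨n - 1, by omega⟩ (by simp only [Fin.lt_def]; omega)
        rwa [full a _ hlast, full b _ hlast] at this
      · intro j hj
        rw [Fin.lt_def] at hj
        have hj' := j.isLt
        simp only at hj
        have e1 := h1 j (by rw [Fin.lt_def]; omega)
        have e2 := h1 ⟨j.val - 1, by omega⟩ (by simp only [Fin.lt_def]; omega)
        rw [succ a ⟨j.val - 1, by omega⟩ j (by simp only; omega),
          succ b ⟨j.val - 1, by omega⟩ j (by simp only; omega), e2] at e1
        exact Nat.add_left_cancel e1
      · have e1 := h1 ⟨i.val + 1, hin⟩ (by simp only [Fin.lt_def]; omega)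
        rw [succ a i _ rfl, succ b i _ rfl] at e1
        omega
  · rintro (h | ⟨h, i, h1, h2⟩)
    · have hn : 0 < n := by
        rcases Nat.eq_zero_or_pos n with h0 | h0
        · subst h0; simp at h
        · exact h0
      refine ⟨⟨n - 1, by omega⟩, ?_, ?_⟩
      · intro j hj
        have := j.isLt
        simp only [Fin.lt_def] at hj
        omega
      · rwa [full a _ (by simp only; omega), full b _ (by simp only; omega)]
    · have hle : ∀ k : Fin n, i ≤ k → ∑ l ∈ Finset.Iic k, a l = ∑ l ∈ Finset.Iic k, b l := by
        intro k hk
        have ha := DRL.sum_split a k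
        have hb := DRL.sum_split b k
        have := tail k fun j hj => h1 j (lt_of_le_of_lt hk hj)
        omega
      have e := hle i le_rfl
      rw [DRL.sum_Iic_split, DRL.sum_Iic_split] at e
      have hi : 0 < i.val := by
        rcases Nat.eq_zero_or_pos i.val with h0 | h0
        · have hemp : Finset.Iio i = ∅ := by
            ext x; simp [Fin.lt_def, h0]
          rw [hemp] at e
          simp at e
          omega
        · exact h0
      have hin := i.isLt
      refine ⟨⟨i.val - 1, by omega⟩, ?_, ?_⟩
      · intro j hj
        refine hle j ?_
        simp only [Fin.lt_def] at hj
        rw [Fin.le_def]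
        omega
      · have e' := hle i le_rfl
        rw [succ a ⟨i.val - 1, by omega⟩ i (by simp only; omega),
          succ b ⟨i.val - 1, by omega⟩ i (by simp only; omega)] at e'
        omega

/-! ### Gröbner bases, staircases, shape position -/

section Groebner

variable {σ K : Type*} [Field K]

/-- `G` is a Gröbner basis of `I`: it lies in `I`, and the leading monomial of every nonzero
element of `I` is divisible by the leading monomial of a nonzero element of `G`. -/
def IsGroebnerBasis (m : MonomialOrder σ) (I : Ideal (MvPolynomial σ K))
    (G : Set (MvPolynomial σ K)) : Prop :=
  (∀ g ∈ G, g ∈ I) ∧ ∀ f ∈ I, f ≠ 0 → ∃ g ∈ G, g ≠ 0 ∧ m.degree g ≤ m.degree f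

/-- `G` is the reduced (hence minimal) Gröbner basis of `I`: its elements are monic and no monomial
of an element of `G` is divisible by the leading monomial of another element of `G`. -/
structure IsReducedGroebnerBasis (m : MonomialOrder σ) (I : Ideal (MvPolynomial σ K))
    (G : Finset (MvPolynomial σ K)) : Prop where
  isGroebnerBasis : IsGroebnerBasis m I (G : Set (MvPolynomial σ K))
  monic : ∀ g ∈ G, m.Monic g
  reduced : ∀ g ∈ G, ∀ h ∈ G, h ≠ g → ∀ c ∈ g.support, ¬ m.degree h ≤ c

/-- The staircase of `G`: the monomials, as exponent vectors, that are divisible by no leading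
monomial of an element of `G`. -/
def staircase (m : MonomialOrder σ) (G : Finset (MvPolynomial σ K)) : Set (σ →₀ ℕ) :=
  {r | ∀ g ∈ G, ¬ m.degree g ≤ r}

end Groebner

/-- The index of the last variable. -/
def lastVar {n : ℕ} (hn : 0 < n) : Fin n := ⟨n - 1, Nat.sub_lt hn Nat.one_pos⟩

section Ideals

variable {K : Type*} [Field K]

/-- Shape position: for the lexicographic order with the last variable `x` least, `I` has a
Gröbner basis `{X i - gᵢ(x) | i not last} ∪ {g(x)}` with `g` a nonzero univariate polynomial
(whose degree is then the dimension of the quotient by `I`). -/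
def InShapePosition {n : ℕ} (hn : 0 < n) (I : Ideal (MvPolynomial (Fin n) K)) : Prop :=
  ∃ (q : Fin n → Polynomial K) (g : Polynomial K), g ≠ 0 ∧
    IsGroebnerBasis MonomialOrder.lex I
      ({f | ∃ i, i ≠ lastVar hn ∧ f = X i - Polynomial.aeval (X (lastVar hn)) (q i)} ∪
        {Polynomial.aeval (X (lastVar hn)) g})

/-! ### Hilbert series -/

/-- The ideal generated by the top-degree forms of the elements of `I`. The associated graded
algebra of the filtered algebra `K[x] / I` is `K[x]` modulo this ideal, which is `I` itself when `I`
is homogeneous. -/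
noncomputable def topFormIdeal {σ : Type*} (I : Ideal (MvPolynomial σ K)) : Ideal (MvPolynomial σ K) :=
  Ideal.span {h | ∃ f ∈ I, h = homogeneousComponent f.totalDegree f}

/-- The Hilbert series of `K[x] / J` for a homogeneous ideal `J`: the coefficient of `t ^ k` is the
dimension of the image of the forms of degree `k`. -/
noncomputable def gradedHilbertSeries {σ : Type*} (J : Ideal (MvPolynomial σ K)) : PowerSeries ℤ :=
  PowerSeries.mk fun k => (Module.finrank K
    ((homogeneousSubmodule σ K k).map (Ideal.Quotient.mkₐ K J).toLinearMap) : ℤ)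

/-- The Hilbert series `H` of `K[x] / I`, graded by top-degree forms. -/
noncomputable def hilbertSeries {σ : Type*} (I : Ideal (MvPolynomial σ K)) : PowerSeries ℤ :=
  gradedHilbertSeries (topFormIdeal I)

/-- The Hilbert series `HQ_e` of the quotient of `K[x] / I`, graded by top-degree forms, by the
`e`-th power of the last variable. -/
noncomputable def hilbertSeriesQuot {n : ℕ} (hn : 0 < n) (I : Ideal (MvPolynomial (Fin n) K))
    (e : ℕ) : PowerSeries ℤ :=
  gradedHilbertSeries (topFormIdeal I ⊔ Ideal.span {X (lastVar hn) ^ e})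

end Ideals

/-- `[S]₊`: the series `S` truncated at its first non-positive coefficient. -/
noncomputable def truncPos (S : PowerSeries ℤ) : PowerSeries ℤ :=
  open Classical in
  PowerSeries.mk fun k => if ∀ j ≤ k, 0 < PowerSeries.coeff j S then PowerSeries.coeff k S else 0

/-- The `(p-1) × (p-1)` matrix `P(t)` whose `(i, j)` entry, for `1 ≤ i, j ≤ p - 1`, is
`∑ k, (p - i).choose k * (n - 1 - j).choose k * t ^ k`. -/
noncomputable def binomMatrix (n p : ℕ) (t : PowerSeries ℤ) : Matrix (Fin (p - 1)) (Fin (p - 1)) (PowerSeries ℤ) :=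
  Matrix.of fun i j => ∑ k ∈ Finset.range (p + 1),
    (((p - (i.val + 1)).choose k * (n - 1 - (j.val + 1)).choose k : ℕ) : PowerSeries ℤ) * t ^ k

/-- `S = det P(t^(d-1)) / t^((d-1) * C(p-1, 2)) * (1 - t^d)^p * (1 - t^(d-1))^(n-p) / (1 - t)^n`,
with the (non-zero-divisor) denominators multiplied out. -/
def IsDeterminantalSeries (n p d : ℕ) (S : PowerSeries ℤ) : Prop :=
  S * PowerSeries.X ^ ((d - 1) * (p - 1).choose 2) * (1 - PowerSeries.X) ^ n =
    (binomMatrix n p (PowerSeries.X ^ (d - 1))).det *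
      (1 - PowerSeries.X ^ d) ^ p * (1 - PowerSeries.X ^ (d - 1)) ^ (n - p)

/-- Generic determinantal ideals with parameters `n, p, d` (over an infinite field). -/
structure IsGenericDeterminantalIdeal {K : Type*} [Field K] {n : ℕ} (hn : 0 < n) (p d : ℕ)
    (I : Ideal (MvPolynomial (Fin n) K)) : Prop where
  shape : InShapePosition hn I
  hilbert : IsDeterminantalSeries n p d (hilbertSeries I)
  froberg : ∀ e : ℕ, 1 ≤ e →
    hilbertSeriesQuot hn I e = truncPos ((1 - PowerSeries.X ^ e) * hilbertSeries I)

/-! ### The homogeneous ideal of top forms, and dimension counts modulo it. -/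

section TopForms

variable {σ K : Type*} [Field K]

/-! Write x for the last variable and A for the associated graded algebra. If x·b is neither in E
nor a leading monomial of G, some leading monomial u of G divides x·b properly. Since u does not
divide b, it has x-exponent e = (x-exponent of b) + 1, so properness occurs at another variable y: u
divides x·b/y = a·x^e, where a divides b and hence lies in E. It remains to see that a·x^e lies in
E.

By the choice of e, b is not divisible by x^e, and it survives in A/(x^e)
(`IsGroebnerBasis.monomial_notMem_sup`). So HQ_e is nonzero in degree k = deg b, the truncation has
not yet taken effect there, and its coefficient is H_k - H_{k-e}. This dimension forces
multiplication by x^e from A_{k-e} to A_k to be injective (`mem_of_X_pow_mul_mem`).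

In DRL, a form whose leading monomial is divisible by x^e is itself divisible by x^e. Injectivity
therefore turns a top form led by a·x^e into one led by a, which is impossible for a in E
(`IsGroebnerBasis.add_single_mem_staircase`). -/

theorem homogeneousComponent_monomial_mul (k : ℕ) (s : σ →₀ ℕ) (c : K) (f : MvPolynomial σ K) :
    homogeneousComponent k (monomial s c * f) =
      if s.degree ≤ k then monomial s c * homogeneousComponent (k - s.degree) f else 0 := by
  ext d
  rw [coeff_homogeneousComponent, coeff_monomial_mul']
  by_cases hs : s ≤ d
  · obtain ⟨u, rfl⟩ := exists_add_of_le hs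
    rw [if_pos hs, add_tsub_cancel_left, map_add]
    split_ifs with h1 h2 h2
    · rw [coeff_monomial_mul, coeff_homogeneousComponent, if_pos (by omega)]
    · omega
    · rw [coeff_monomial_mul, coeff_homogeneousComponent, if_neg (by omega), mul_zero]
    · simp
  · rw [if_neg hs, ite_self]
    split_ifs
    · rw [coeff_monomial_mul', if_neg hs]
    · simp

theorem homogeneousComponent_mem_topFormIdeal {I : Ideal (MvPolynomial σ K)}
    {F : MvPolynomial σ K} (hF : F ∈ I) {k : ℕ} (hk : F.totalDegree ≤ k) :
    homogeneousComponent k F ∈ topFormIdeal I := by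
  rcases hk.lt_or_eq with h | rfl
  · rw [homogeneousComponent_eq_zero _ _ h]
    exact zero_mem _
  · exact Ideal.subset_span ⟨F, hF, rfl⟩

/-- Homogeneous components of elements of the top-form ideal are top forms (or zero). -/
theorem exists_homogeneousComponent_eq_of_mem_topFormIdeal {I : Ideal (MvPolynomial σ K)}
    {f : MvPolynomial σ K} (hf : f ∈ topFormIdeal I) (k : ℕ) :
    ∃ F ∈ I, F.totalDegree ≤ k ∧ homogeneousComponent k F = homogeneousComponent k f := by
  induction hf using Submodule.span_induction generalizing k with
  | mem x hx =>
    obtain ⟨F, hF, rfl⟩ := hx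
    by_cases h : k = F.totalDegree
    · subst h
      exact ⟨F, hF, le_rfl, by
        rw [homogeneousComponent_eq_self (homogeneousComponent_isHomogeneous _ _)]⟩
    · refine ⟨0, zero_mem _, by simp, ?_⟩
      rw [homogeneousComponent_of_mem (homogeneousComponent_mem _ _), if_neg h, map_zero]
  | zero => exact ⟨0, zero_mem _, by simp, rfl⟩
  | add x y _ _ hx hy =>
    obtain ⟨F, hF, hFk, hFx⟩ := hx k
    obtain ⟨F', hF', hFk', hFy⟩ := hy k
    exact ⟨F + F', add_mem hF hF', (totalDegree_add _ _).trans (max_le hFk hFk'), by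
      rw [map_add, map_add, hFx, hFy]⟩
  | smul a x _ hx =>
    rw [smul_eq_mul]
    -- Multiplying by a monomial only shifts degrees, and the outer induction hypothesis holds in
    -- every degree, so it can be used in degree `k - s.degree`.
    induction a using MvPolynomial.induction_on' with
    | monomial s c =>
      by_cases hs : s.degree ≤ k
      · obtain ⟨F, hF, hFk, hFx⟩ := hx (k - s.degree)
        refine ⟨monomial s c * F, Ideal.mul_mem_left _ _ hF, ?_, ?_⟩
        · refine (totalDegree_mul _ _).trans ?_
          have : (monomial s c).totalDegree ≤ s.degree := totalDegree_monomial_le _ _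
          omega
        · rw [homogeneousComponent_monomial_mul, homogeneousComponent_monomial_mul, hFx]
      · exact ⟨0, zero_mem _, by simp, by
          rw [homogeneousComponent_monomial_mul, if_neg hs, map_zero]⟩
    | add p q hp hq =>
      obtain ⟨F, hF, hFk, hFx⟩ := hp
      obtain ⟨F', hF', hFk', hFy⟩ := hq
      exact ⟨F + F', add_mem hF hF', (totalDegree_add _ _).trans (max_le hFk hFk'), by
        rw [add_mul, map_add, map_add, hFx, hFy]⟩

theorem homogeneousComponent_mem_topFormIdeal_of_mem {I : Ideal (MvPolynomial σ K)}
    {f : MvPolynomial σ K} (hf : f ∈ topFormIdeal I) (k : ℕ) :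
    homogeneousComponent k f ∈ topFormIdeal I := by
  obtain ⟨F, hF, hk, h⟩ := exists_homogeneousComponent_eq_of_mem_topFormIdeal hf k
  exact h ▸ homogeneousComponent_mem_topFormIdeal hF hk

/-- If multiplication by a form `X ^ e` has a cokernel of the expected dimension in degree `k`, then
it is injective on degree `k - e`. -/
theorem mem_of_X_pow_mul_mem [Finite σ] {J : Ideal (MvPolynomial σ K)}
    (hJ : ∀ f ∈ J, ∀ k, homogeneousComponent k f ∈ J) (i : σ) {e k : ℕ} (hek : e ≤ k)
    (hdim : PowerSeries.coeff k (gradedHilbertSeries (J ⊔ Ideal.span {X i ^ e})) =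
      PowerSeries.coeff k (gradedHilbertSeries J) -
        PowerSeries.coeff (k - e) (gradedHilbertSeries J))
    {g : MvPolynomial σ K} (hg : g.IsHomogeneous (k - e)) (hgJ : X i ^ e * g ∈ J) : g ∈ J := by
  classical
  have hfin : ∀ j, Module.Finite K (homogeneousSubmodule σ K j) := fun j =>
    Module.Finite.iff_fg.2 (homogeneousSubmodule_fg σ K j)
  set J' := J ⊔ Ideal.span {X i ^ e} with hJ'
  let π := (Ideal.Quotient.mkₐ K J).toLinearMap
  let π' := (Ideal.Quotient.mkₐ K J').toLinearMap
  let T := (Ideal.Quotient.factorₐ K (le_sup_left : J ≤ J')).toLinearMap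
  have hT : T ∘ₗ π = π' := rfl
  let μ : (MvPolynomial σ K ⧸ J) →ₗ[K] (MvPolynomial σ K ⧸ J) :=
    LinearMap.mulLeft K (Ideal.Quotient.mk J (X i ^ e))
  have hμ : ∀ r, μ (π r) = π (X i ^ e * r) := fun r => (map_mul (Ideal.Quotient.mk J) _ _).symm
  have hπ : ∀ r, π r = 0 ↔ r ∈ J := fun r => Ideal.Quotient.eq_zero_iff_mem
  have hπ' : ∀ r, π' r = 0 ↔ r ∈ J' := fun r => Ideal.Quotient.eq_zero_iff_mem
  let U := (homogeneousSubmodule σ K (k - e)).map π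
  let V := (homogeneousSubmodule σ K k).map π
  have : Module.Finite K U := inferInstance
  have : Module.Finite K V := inferInstance
  have hVT : V.map T = (homogeneousSubmodule σ K k).map π' := by
    rw [← hT, Submodule.map_comp]
  -- A form of degree `k` lying in `J'` is, modulo `J`, `X i ^ e` times a form of degree `k - e`:
  -- take degree-`k` components, `J` being homogeneous.
  have hker : (LinearMap.ker (T.domRestrict V)).map V.subtype ≤ U.map μ := by
    rintro _ ⟨⟨v, hv⟩, hv0, rfl⟩
    obtain ⟨r, hr, rfl⟩ := hv
    have hr' : r ∈ J' := (hπ' r).1 hv0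
    obtain ⟨j, hj, s, hs, rfl⟩ := Submodule.mem_sup.1 hr'
    obtain ⟨a, rfl⟩ := Ideal.mem_span_singleton'.1 hs
    have h1 : homogeneousComponent k (a * X i ^ e) =
        X i ^ e * homogeneousComponent (k - e) a := by
      rw [mul_comm, X_pow_eq_monomial, homogeneousComponent_monomial_mul, Finsupp.degree_single,
        if_pos hek]
    refine ⟨π (homogeneousComponent (k - e) a),
      ⟨_, homogeneousComponent_mem _ _, rfl⟩, ?_⟩
    rw [hμ, ← h1]
    change π _ = π _
    rw [← sub_eq_zero, ← map_sub, hπ]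
    have h2 := homogeneousComponent_eq_self ((mem_homogeneousSubmodule _ _).1 hr)
    have h3 : homogeneousComponent k (a * X i ^ e) - (j + a * X i ^ e) =
        - homogeneousComponent k j := by
      rw [map_add] at h2
      rw [← h2]
      ring
    rw [h3]
    exact neg_mem (hJ j hj k)
  have hrank := LinearMap.finrank_range_add_finrank_ker (T.domRestrict V)
  rw [LinearMap.range_domRestrict, hVT] at hrank
  replace hrank : Module.finrank K ((homogeneousSubmodule σ K k).map π') +
    Module.finrank K (LinearMap.ker (T.domRestrict V)) = Module.finrank K V := hrank
  have hle := Submodule.finrank_mono hker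
  rw [Submodule.finrank_map_subtype_eq] at hle
  have hrank2 := LinearMap.finrank_range_add_finrank_ker (μ.domRestrict U)
  rw [LinearMap.range_domRestrict] at hrank2
  have hdim' : (Module.finrank K ((homogeneousSubmodule σ K k).map π') : ℤ) =
      Module.finrank K V - Module.finrank K U := by
    simpa only [gradedHilbertSeries, PowerSeries.coeff_mk] using hdim
  -- dim μ(U) ≥ dim ker T|V = dim V - dim T(V) = dim U, so μ loses no dimension on U.
  have hker0 : Module.finrank K (LinearMap.ker (μ.domRestrict U)) = 0 := by omega
  have hbot := Submodule.finrank_eq_zero.1 hker0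
  have hmem : (⟨π g, g, hg, rfl⟩ : U) ∈ LinearMap.ker (μ.domRestrict U) := by
    change μ (π g) = 0
    rw [hμ, hπ]
    exact hgJ
  rw [hbot, Submodule.mem_bot] at hmem
  exact (hπ g).1 (congrArg Subtype.val hmem)

theorem coeff_truncPos_of_ne_zero {S : PowerSeries ℤ} {k : ℕ}
    (h : PowerSeries.coeff k (truncPos S) ≠ 0) :
    PowerSeries.coeff k (truncPos S) = PowerSeries.coeff k S := by
  rw [truncPos, PowerSeries.coeff_mk] at h ⊢
  exact if_pos (of_not_not fun h' => h (if_neg h'))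

end TopForms

/-! ### Degree reverse lexicographic order and leading monomials of top forms. -/

section DegRevLex

open scoped MonomialOrder

variable {n : ℕ}

theorem drl_degree_le_of_le {a b : Fin n →₀ ℕ} (h : a ≼[drl n] b) : a.degree ≤ b.degree := by
  rw [Finsupp.degree_eq_sum, Finsupp.degree_eq_sum]
  rcases h.lt_or_eq with h | h
  · rcases (drl_lt_iff a b).1 h with h | h
    · exact h.le
    · exact h.1.le
  · rw [(drl n).toSyn.injective h]

theorem drl_lt_of_degree_lt {a b : Fin n →₀ ℕ} (h : a.degree < b.degree) : a ≺[drl n] b := by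
  rw [Finsupp.degree_eq_sum, Finsupp.degree_eq_sum] at h
  exact (drl_lt_iff a b).2 (Or.inl h)

/-- This is the feature of DRL behind the whole argument: in a fixed degree, the last variable is
examined first, and a larger exponent there makes a monomial smaller. -/
theorem drl_last_le_of_le (hn : 0 < n) {a b : Fin n →₀ ℕ} (hd : a.degree = b.degree)
    (h : a ≼[drl n] b) : b (lastVar hn) ≤ a (lastVar hn) := by
  rw [Finsupp.degree_eq_sum, Finsupp.degree_eq_sum] at hd
  rcases h.lt_or_eq with h | h
  · rcases (drl_lt_iff a b).1 h with h | ⟨_, i, h1, h2⟩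
    · omega
    · have hi : i ≤ lastVar hn := by
        have := i.isLt
        rw [Fin.le_def, lastVar]
        simp only
        omega
      rcases hi.lt_or_eq with hi | rfl
      · exact (h1 _ hi).ge
      · exact h2.le
  · rw [(drl n).toSyn.injective h]

variable {K : Type*} [Field K]

theorem MonomialOrder.degree_eq_of_forall_le {σ : Type*} (m : MonomialOrder σ)
    {f : MvPolynomial σ K} {d : σ →₀ ℕ} (hd : d ∈ f.support)
    (h : ∀ c ∈ f.support, c ≼[m] d) : m.degree f = d :=
  m.toSyn.injective (le_antisymm (m.degree_le_iff.2 h) (m.le_degree hd))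

theorem drl_degree_degree {f : MvPolynomial (Fin n) K} (hf : f ≠ 0) :
    ((drl n).degree f).degree = f.totalDegree := by
  have hs := (drl n).degree_mem_support hf
  refine le_antisymm (le_totalDegree hs) (Finset.sup_le fun s h => ?_)
  exact drl_degree_le_of_le ((drl n).le_degree h)

/-- The DRL leading monomial of a polynomial is that of its top-degree form. -/
theorem drl_degree_homogeneousComponent {f : MvPolynomial (Fin n) K} {k : ℕ}
    (hk : f.totalDegree ≤ k) (h : homogeneousComponent k f ≠ 0) :
    (drl n).degree f = (drl n).degree (homogeneousComponent k f) := by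
  have hs := (drl n).degree_mem_support h
  have hsupp : ∀ c, c ∈ (homogeneousComponent k f).support ↔ c.degree = k ∧ c ∈ f.support := by
    intro c
    rw [mem_support_iff, coeff_homogeneousComponent, mem_support_iff]
    split_ifs with hc <;> simp [hc]
  refine (drl n).degree_eq_of_forall_le ((hsupp _).1 hs).2 fun c hc => ?_
  have hck : c.degree ≤ k := (le_totalDegree hc).trans hk
  rcases hck.lt_or_eq with hck | hck
  · exact (drl_lt_of_degree_lt (by rw [((hsupp _).1 hs).1]; exact hck)).le
  · exact (drl n).le_degree ((hsupp c).2 ⟨hck, hc⟩)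

end DegRevLex

/-! ### Multiplication by powers of the last variable on the staircase. -/

section Staircase

open scoped MonomialOrder

variable {K : Type*} [Field K]

theorem IsGroebnerBasis.degree_notMem_staircase {σ : Type*} {m : MonomialOrder σ}
    {I : Ideal (MvPolynomial σ K)} {G : Finset (MvPolynomial σ K)}
    (hG : IsGroebnerBasis m I (G : Set (MvPolynomial σ K))) {f : MvPolynomial σ K}
    (hf : f ∈ I) (h0 : f ≠ 0) : m.degree f ∉ staircase m G := by
  obtain ⟨g, hg, _, hle⟩ := hG.2 f hf h0
  exact fun h => h g hg hle

variable {n : ℕ} {I : Ideal (MvPolynomial (Fin n) K)} {G : Finset (MvPolynomial (Fin n) K)}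

/-- A nonzero form in the top-form ideal is the top form of an element of `I`, with the same DRL
leading monomial. -/
theorem IsGroebnerBasis.degree_notMem_staircase_of_mem_topFormIdeal
    (hG : IsGroebnerBasis (drl n) I (G : Set (MvPolynomial (Fin n) K)))
    {f : MvPolynomial (Fin n) K} {k : ℕ} (hfk : f.IsHomogeneous k) (hf : f ∈ topFormIdeal I)
    (h0 : f ≠ 0) : (drl n).degree f ∉ staircase (drl n) G := by
  obtain ⟨F, hF, hFk, h⟩ := exists_homogeneousComponent_eq_of_mem_topFormIdeal hf k
  rw [homogeneousComponent_eq_self hfk] at h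
  rw [← h] at h0 ⊢
  rw [← drl_degree_homogeneousComponent hFk h0]
  refine hG.degree_notMem_staircase hF ?_
  rintro rfl
  exact h0 (map_zero _)

/-- A monomial of the staircase that is not divisible by `X ^ e`, with `X` the last variable, does
not vanish modulo the top forms and `X ^ e`. -/
theorem IsGroebnerBasis.monomial_notMem_sup
    (hG : IsGroebnerBasis (drl n) I (G : Set (MvPolynomial (Fin n) K))) (hn : 0 < n)
    {b : Fin n →₀ ℕ} (hb : b ∈ staircase (drl n) G) {e : ℕ} (he : b (lastVar hn) < e) :
    monomial b (1 : K) ∉ topFormIdeal I ⊔ Ideal.span {X (lastVar hn) ^ e} := by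
  intro hmem
  obtain ⟨j, hj, s, hs, hjs⟩ := Submodule.mem_sup.1 hmem
  obtain ⟨a, rfl⟩ := Ideal.mem_span_singleton'.1 hs
  set f := homogeneousComponent b.degree j with hf
  have hfJ : f ∈ topFormIdeal I := homogeneousComponent_mem_topFormIdeal_of_mem hj _
  have hfh : f.IsHomogeneous b.degree := homogeneousComponent_isHomogeneous _ _
  -- `j` and the monomial `b` differ by a multiple of `X ^ e`, which has no such terms.
  have hcoeff : ∀ c : Fin n →₀ ℕ, c (lastVar hn) < e →
      coeff c j = coeff c (monomial b (1 : K)) := by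
    intro c hc
    rw [← hjs, coeff_add, X_pow_eq_monomial, coeff_mul_monomial', if_neg, add_zero]
    rw [Finsupp.single_le_iff]
    omega
  have hbf : b ∈ f.support := by
    rw [mem_support_iff, hf, coeff_homogeneousComponent, if_pos rfl, hcoeff b he, coeff_monomial,
      if_pos rfl]
    exact one_ne_zero
  refine hG.degree_notMem_staircase_of_mem_topFormIdeal hfh hfJ
    (fun h => by simp [h] at hbf) ?_
  rwa [(drl n).degree_eq_of_forall_le hbf]
  -- A term of `f` above `b` would have last exponent at most that of `b`, hence below `e`; there
  -- `hcoeff` leaves only `b` itself.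
  intro c hc
  have hcd : c.degree = b.degree := by
    by_contra h
    exact mem_support_iff.1 hc (hfh.coeff_eq_zero h)
  by_contra hlt
  rw [not_le] at hlt
  have hlast := drl_last_le_of_le hn hcd.symm hlt.le
  have hcj := mem_support_iff.1 hc
  rw [hf, coeff_homogeneousComponent, if_pos hcd, hcoeff c (hlast.trans_lt he),
    coeff_monomial] at hcj
  have hbc : b = c := by
    by_contra h
    exact hcj (if_neg h)
  rw [hbc] at hlt
  exact lt_irrefl _ hlt

theorem coeff_gradedHilbertSeries_ne_zero {σ : Type*} [Finite σ] {J : Ideal (MvPolynomial σ K)}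
    {b : σ →₀ ℕ} (hb : monomial b (1 : K) ∉ J) :
    PowerSeries.coeff b.degree (gradedHilbertSeries J) ≠ 0 := by
  have : Module.Finite K (homogeneousSubmodule σ K b.degree) :=
    Module.Finite.iff_fg.2 (homogeneousSubmodule_fg σ K _)
  rw [gradedHilbertSeries, PowerSeries.coeff_mk, Nat.cast_ne_zero, Ne, Submodule.finrank_eq_zero]
  intro h
  have hmem := Submodule.mem_map_of_mem (f := (Ideal.Quotient.mkₐ K J).toLinearMap)
    ((mem_homogeneousSubmodule _ _).2 (isHomogeneous_monomial (1 : K) (rfl : b.degree = b.degree)))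
  rw [h, Submodule.mem_bot] at hmem
  exact hb (Ideal.Quotient.eq_zero_iff_mem.1 hmem)

/-- If `X ^ e`, with `X` the last variable, is not surjective onto degree `k` of the associated
graded algebra, then multiplication by it preserves the staircase in degree `k - e`. -/
theorem IsGroebnerBasis.add_single_mem_staircase
    (hG : IsGroebnerBasis (drl n) I (G : Set (MvPolynomial (Fin n) K))) (hn : 0 < n)
    (hfr : ∀ e : ℕ, 1 ≤ e →
      hilbertSeriesQuot hn I e = truncPos ((1 - PowerSeries.X ^ e) * hilbertSeries I))
    {b : Fin n →₀ ℕ} (hb : b ∈ staircase (drl n) G) {e : ℕ} (he : b (lastVar hn) < e)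
    {a : Fin n →₀ ℕ} (ha : a ∈ staircase (drl n) G) (hab : a.degree + e = b.degree) :
    a + Finsupp.single (lastVar hn) e ∈ staircase (drl n) G := by
  have hne := coeff_gradedHilbertSeries_ne_zero (hG.monomial_notMem_sup hn hb he)
  have hdim : PowerSeries.coeff b.degree (hilbertSeriesQuot hn I e) =
      PowerSeries.coeff b.degree (hilbertSeries I) -
        PowerSeries.coeff (b.degree - e) (hilbertSeries I) := by
    change PowerSeries.coeff b.degree (hilbertSeriesQuot hn I e) ≠ 0 at hne
    rw [hfr e (by omega)] at hne ⊢
    rw [coeff_truncPos_of_ne_zero hne, sub_mul, one_mul, map_sub, PowerSeries.coeff_X_pow_mul',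
      if_pos (by omega)]
  by_contra hc
  obtain ⟨g, hg, hgle⟩ : ∃ g ∈ G, (drl n).degree g ≤ a + Finsupp.single (lastVar hn) e := by
    simpa [staircase] using hc
  -- The zero polynomial has `degree` 0 by convention, which would divide `a`.
  have hg0 : g ≠ 0 := by
    rintro rfl
    exact ha 0 hg (by rw [MonomialOrder.degree_zero]; exact zero_le)
  obtain ⟨u, hu⟩ := exists_add_of_le hgle
  have hu0 : monomial u (1 : K) ≠ 0 := by simp
  set f := monomial u (1 : K) * g with hf
  have hf0 : f ≠ 0 := mul_ne_zero hu0 hg0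
  have hfdeg : (drl n).degree f = a + Finsupp.single (lastVar hn) e := by
    classical
    rw [hf, MonomialOrder.degree_mul hu0 hg0, MonomialOrder.degree_monomial,
      if_neg one_ne_zero, hu, add_comm]
  have hftot : f.totalDegree = b.degree := by
    rw [← drl_degree_degree hf0, hfdeg, map_add, Finsupp.degree_single, hab]
  set F := homogeneousComponent b.degree f with hF
  have hFJ : F ∈ topFormIdeal I :=
    homogeneousComponent_mem_topFormIdeal (Ideal.mul_mem_left _ _ (hG.1 g hg)) hftot.le
  have hFh : F.IsHomogeneous b.degree := homogeneousComponent_isHomogeneous _ _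
  have hF0 : F ≠ 0 := by
    intro h
    have h1 := (drl n).degree_mem_support hf0
    have h2 : ((drl n).degree f).degree = b.degree := (drl_degree_degree hf0).trans hftot
    have h3 := congrArg (coeff ((drl n).degree f)) h
    rw [hF, coeff_homogeneousComponent, if_pos h2, coeff_zero] at h3
    exact mem_support_iff.1 h1 h3
  have hFdeg : (drl n).degree F = a + Finsupp.single (lastVar hn) e := by
    rw [← drl_degree_homogeneousComponent hftot.le hF0, hfdeg]
  -- All terms of the form `F` have last exponent at least that of its DRL leading monomial, which
  -- is at least `e`.
  obtain ⟨r, hr⟩ : X (lastVar hn) ^ e ∣ F := by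
    rw [X_pow_eq_monomial, monomial_one_dvd_iff_modMonomial_eq_zero]
    ext c
    rw [coeff_zero]
    by_cases hle : Finsupp.single (lastVar hn) e ≤ c
    · exact coeff_modMonomial_of_le _ hle
    · rw [coeff_modMonomial_of_not_le _ hle]
      by_contra hcF
      refine hle ?_
      rw [Finsupp.single_le_iff]
      have hle' := (drl n).le_degree (mem_support_iff.2 hcF)
      have hcd : c.degree = ((drl n).degree F).degree := by
        rw [drl_degree_degree hF0, hFh.totalDegree hF0]
        by_contra h
        exact hcF (hFh.coeff_eq_zero h)
      have hlast := drl_last_le_of_le hn hcd hle'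
      rw [hFdeg, Finsupp.add_apply, Finsupp.single_eq_same] at hlast
      omega
  have hX0 : (X (lastVar hn) : MvPolynomial (Fin n) K) ^ e ≠ 0 := pow_ne_zero _ (X_ne_zero _)
  have hr0 : r ≠ 0 := by
    rintro rfl
    exact hF0 (by rw [hr, mul_zero])
  have hrh : r.IsHomogeneous (b.degree - e) := by
    have h1 := homogeneousComponent_eq_self hFh
    rw [hr, X_pow_eq_monomial, homogeneousComponent_monomial_mul, Finsupp.degree_single,
      if_pos (by omega)] at h1
    rw [X_pow_eq_monomial] at hX0
    rw [← mul_left_cancel₀ hX0 h1]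
    exact homogeneousComponent_isHomogeneous _ _
  have hrJ : r ∈ topFormIdeal I :=
    mem_of_X_pow_mul_mem (fun f hf k => homogeneousComponent_mem_topFormIdeal_of_mem hf k)
      (lastVar hn) (by omega) hdim hrh (hr ▸ hFJ)
  have hrdeg : (drl n).degree r = a := by
    classical
    have h1 := hFdeg
    rw [hr, MonomialOrder.degree_mul hX0 hr0, X_pow_eq_monomial, MonomialOrder.degree_monomial,
      if_neg one_ne_zero, add_comm] at h1
    exact add_right_cancel h1
  exact hG.degree_notMem_staircase_of_mem_topFormIdeal hrh hrJ hr0 (hrdeg ▸ ha)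

end Staircase

/-! ### The staircase in the direction of the last variable. -/

theorem mainTheorem4 {K : Type*} [Field K] [Infinite K] (n p d : ℕ)
    (hp : 1 ≤ p) (hpn : p < n) (hd : 1 ≤ d)
    (I : Ideal (MvPolynomial (Fin n) K))
    (hI : IsGenericDeterminantalIdeal (Nat.zero_lt_of_lt hpn) p d I)
    (G : Finset (MvPolynomial (Fin n) K))
    (hG : IsReducedGroebnerBasis (drl n) I G) :
    ∀ b ∈ staircase (drl n) G,
      b + Finsupp.single (lastVar (Nat.zero_lt_of_lt hpn)) 1 ∈ staircase (drl n) G ∨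
        ∃ g ∈ G, (drl n).degree g =
          b + Finsupp.single (lastVar (Nat.zero_lt_of_lt hpn)) 1 := by
  intro b hb
  have hn : 0 < n := Nat.zero_lt_of_lt hpn
  set l := lastVar (Nat.zero_lt_of_lt hpn) with hl
  by_contra! hcon
  obtain ⟨h1, h2⟩ := hcon
  obtain ⟨g, hg, hle⟩ : ∃ g ∈ G, (drl n).degree g ≤ b + Finsupp.single l 1 := by
    simpa [staircase] using h1
  obtain ⟨i, hi⟩ : ∃ i : Fin n, (drl n).degree g i < (b + Finsupp.single l 1 : Fin n →₀ ℕ) i := by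
    by_contra! h
    exact h2 g hg (le_antisymm hle h)
  -- Strict inequality at `l` would already make the leading monomial of `g` divide `b`.
  have hil : i ≠ l := by
    intro hil
    rw [hil] at hi
    refine hb g hg fun j => ?_
    by_cases hj : j = l
    · rw [hj]
      rw [Finsupp.add_apply, Finsupp.single_eq_same] at hi
      omega
    · have := hle j
      rwa [Finsupp.add_apply, Finsupp.single_eq_of_ne hj, add_zero] at this
  have hbi : 1 ≤ b i := by
    rw [Finsupp.add_apply, Finsupp.single_eq_of_ne hil] at hi
    omega
  -- `b = a + (b l) • l + i`
  have hsum : Finsupp.single l (b l) + Finsupp.single i 1 ≤ b := by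
    intro j
    rw [Finsupp.add_apply]
    by_cases hj : j = l
    · subst hj
      rw [Finsupp.single_eq_same, Finsupp.single_eq_of_ne hil.symm, add_zero]
    · rw [Finsupp.single_eq_of_ne hj, zero_add]
      by_cases hji : j = i
      · subst hji
        rwa [Finsupp.single_eq_same]
      · rw [Finsupp.single_eq_of_ne hji]
        exact zero_le
  obtain ⟨a, ha⟩ := exists_add_of_le hsum
  have haE : a ∈ staircase (drl n) G := fun h hh hle' =>
    hb h hh (hle'.trans (by rw [ha]; exact le_add_self))
  have hdeg : a.degree + (b l + 1) = b.degree := by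
    have := congrArg Finsupp.degree ha
    rw [map_add, map_add, Finsupp.degree_single, Finsupp.degree_single] at this
    omega
  -- The exponent `b l + 1` is the least whose power of the last variable does not divide `b`. What
  -- remains is that the leading monomial of `g` divides `a` times this power, the strict inequality
  -- at `i` paying for the lost factor.
  refine hG.isGroebnerBasis.add_single_mem_staircase hn hI.froberg hb
    (Nat.lt_succ_self (b l)) haE hdeg g hg fun j => ?_
  have hj := hle j
  have haj := DFunLike.congr_fun ha j
  simp only [Finsupp.add_apply] at hj haj ⊢
  change _ ≤ a j + Finsupp.single l (b l + 1) j
  rw [Finsupp.single_add, Finsupp.add_apply]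
  by_cases hji : j = i
  · subst hji
    rw [Finsupp.single_eq_same] at haj
    rw [Finsupp.add_apply] at hi
    omega
  · rw [Finsupp.single_eq_of_ne hji] at haj
    omega
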